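/- Let $m,d\in\mathbb{N}=\{1,2,\ldots\}$, $q\in\mathbb{N}_0$, let $(Z_t)_{t\in\mathbb{Z}}$ be an i.i.d. sequence of $\mathbb{C}^d$-valued random vectors on a probability space $(\Omega,\mathcal{F},\mathbb{P})$, and let $\Psi_1\in\mathbb{C}^{m\times m}$ and $\Theta_0,\ldots,\Theta_q\in\mathbb{C}^{m\times d}$ be deterministic matrices. Let $\|\cdot\|$ be any norm on $\mathbb{C}^m$ and $\log^+(x):=\log\max\{1,x\}$. Suppose that every eigenvalue of $\Psi_1$ has absolute value in $(0,1)\cup(1,\infty)$. Then there exists a strictly stationary process $(Y_t)_{t\in\mathbb{Z}}$ of $\mathbb{C}^m$-valued random vectors on $(\Omega,\mathcal{F},\mathbb{P})$ (that is, one whose finite-dimensional distributions are all invariant under time shifts) that satisfies almost surely $$Y_t-\Psi_1Y_{t-1}=\sum_{k=0}^q\Theta_kZ_{t-k},\qquad t\in\mathbb{Z},$$ if and only if $$\mathbb{E}\log^+\left\|\left(\sum_{k=0}^q\Psi_1^{q-k}\Theta_k\right)Z_0\right\|<\infty.$$ -/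

import Mathlib

open MeasureTheory ProbabilityTheory
open scoped Matrix

/-- A `ℤ`-indexed sequence of random vectors in `ℂ^d` is i.i.d.: every `Z t` is a random vector
(a measurable function), the family is mutually independent, and all `Z t` have the same law. -/
structure IsIIDSequence {Ω : Type*} [MeasurableSpace Ω] (P : Measure Ω) {d : ℕ}
    (Z : ℤ → Ω → (Fin d → ℂ)) : Prop where
  measurable : ∀ t : ℤ, Measurable (Z t)
  indep : iIndepFun Z P
  identDistrib : ∀ t : ℤ, IdentDistrib (Z t) (Z 0) P P

/-- A `ℤ`-indexed process of random vectors in `ℂ^m` is strictly stationary: all its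
finite-dimensional distributions are invariant under time shifts. -/
structure IsStrictlyStationary {Ω : Type*} [MeasurableSpace Ω] (P : Measure Ω) {m : ℕ}
    (Y : ℤ → Ω → (Fin m → ℂ)) : Prop where
  measurable : ∀ t : ℤ, Measurable (Y t)
  map_shift : ∀ (n : ℕ) (t : Fin n → ℤ) (h : ℤ),
    P.map (fun ω (i : Fin n) => Y (t i + h) ω) = P.map (fun ω (i : Fin n) => Y (t i) ω)

/-- `Y` solves, almost surely, the ARMA(1,q) equation
`Y_t - Ψ Y_{t-1} = Θ_0 Z_t + ⋯ + Θ_q Z_{t-q}` for all `t ∈ ℤ`. -/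
def SolvesARMAOne {Ω : Type*} [MeasurableSpace Ω] (P : Measure Ω) {m d q : ℕ}
    (Ψ : Matrix (Fin m) (Fin m) ℂ) (Θ : Fin (q + 1) → Matrix (Fin m) (Fin d) ℂ)
    (Z : ℤ → Ω → (Fin d → ℂ)) (Y : ℤ → Ω → (Fin m → ℂ)) : Prop :=
  ∀ᵐ ω ∂P, ∀ t : ℤ,
    Y t ω - Ψ *ᵥ Y (t - 1) ω = ∑ k : Fin (q + 1), Θ k *ᵥ Z (t - ((k : ℕ) : ℤ)) ω

/-! Write `A` for multiplication by `Ψ`, `B` for its inverse and `C = ∑ k, B ^ k * Θ k`. A finite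
moving average of the noise (`maCorrection`) solves the equation with right side `∑ k, Θ k Z_{t-k} -
C Z_t`. Subtracting it from `Y` leaves the AR(1) equation `X_t = A X_{t-1} + C Z_t` with i.i.d.
noise. The matrix in the theorem is `A ^ q * C` with `A ^ q` invertible, so it suffices to treat the
log moment of `C Z_0`. A spectral projection commuting with `A` separates eigenvalues inside and
outside the unit circle; `A` on the first part and `B` on the second have geometrically decaying
powers.

Sufficiency: a log moment and Borel-Cantelli bound the noise by a slowly growing exponential, so the
stable series over the past and the unstable series over the future converge. The solution is one
measurable functional of the shifted noise, hence stationary.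

Necessity: `X` is bounded in probability, which is all that is used of it. Iterating the recursion
writes blocks of `∑ T ^ j ζ_{-j}` as differences of tight terms. Ottaviani's inequality and the
second Borel-Cantelli lemma make the tails of `T ^ j ζ_{-j}` summable. Since `T` is invertible on
its part, `T ^ j` shrinks vectors at most geometrically, and summable geometric tails are a log
moment. The unstable part is handled by reversing time. -/

/-! ### Spectral splitting and decay of powers -/

open Filter Topology in
/-- Gelfand's formula as geometric decay of powers. -/
theorem exists_norm_pow_le_geometric {𝒜 : Type*} [NormedRing 𝒜] [NormedAlgebra ℂ 𝒜]
    [CompleteSpace 𝒜] (a : 𝒜) (h : ∀ z ∈ spectrum ℂ a, ‖z‖ < 1) :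
    ∃ C ρ : ℝ, 0 ≤ C ∧ 0 < ρ ∧ ρ < 1 ∧ ∀ n : ℕ, ‖a ^ n‖ ≤ C * ρ ^ n := by
  have hr : spectralRadius ℂ a < 1 := by
    rcases (spectrum ℂ a).eq_empty_or_nonempty with he | hne
    · simp [spectralRadius, he]
    · exact_mod_cast spectrum.spectralRadius_lt_of_forall_lt_of_nonempty (r := 1) hne
        (fun k hk => by exact_mod_cast h k hk)
  obtain ⟨r, hr1, hr2⟩ := ENNReal.lt_iff_exists_nnreal_btwn.1 hr
  have hr2' : r < 1 := by exact_mod_cast hr2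
  have hr0 : 0 < r := by exact_mod_cast zero_le.trans_lt hr1
  have ev := (spectrum.pow_nnnorm_pow_one_div_tendsto_nhds_spectralRadius a).eventually_lt_const hr1
  obtain ⟨n₀, hn₀⟩ := (ev.and (eventually_gt_atTop 0)).exists_forall_of_atTop
  have key : ∀ n ≥ n₀, ‖a ^ n‖ ≤ (r : ℝ) ^ n := by
    intro n hn
    obtain ⟨h1, h2⟩ := hn₀ n hn
    have h3 : ((‖a ^ n‖₊ : ENNReal) ^ (1 / (n : ℝ))) ^ (n : ℝ) ≤ (r : ENNReal) ^ (n : ℝ) :=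
      ENNReal.rpow_le_rpow h1.le (by positivity)
    rw [← ENNReal.rpow_mul, one_div, inv_mul_cancel₀ (by positivity), ENNReal.rpow_one,
      ENNReal.rpow_natCast] at h3
    exact_mod_cast h3
  have hr0' : (0 : ℝ) < r := by exact_mod_cast hr0
  -- The sum absorbs the finitely many powers below `n₀`; the `1` serves all later ones.
  refine ⟨1 + ∑ k ∈ Finset.range n₀, ‖a ^ k‖ / (r : ℝ) ^ k, r, by positivity, hr0',
    by exact_mod_cast hr2', fun n => ?_⟩
  rcases lt_or_ge n n₀ with hn | hn
  · have := Finset.single_le_sum (f := fun k => ‖a ^ k‖ / (r : ℝ) ^ k)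
      (fun k _ => by positivity) (Finset.mem_range.2 hn)
    rw [← div_le_iff₀ (by positivity)]
    linarith
  · refine (key n hn).trans (le_mul_of_one_le_left (by positivity) ?_)
    exact le_add_of_nonneg_right (by positivity)

/-- Spectral values of a continuous endomorphism in finite dimension are eigenvalues. -/
theorem exists_eigenvector_of_mem_spectrum {E : Type*} [NormedAddCommGroup E] [NormedSpace ℂ E]
    [FiniteDimensional ℂ E] (T : E →L[ℂ] E) {z : ℂ} (hz : z ∈ spectrum ℂ T) :
    ∃ v, v ≠ 0 ∧ T v = z • v := by
  have := FiniteDimensional.complete ℂ E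
  by_contra! hcon
  refine hz (ContinuousLinearMap.isUnit_iff_bijective.2 ?_)
  have hinj : Function.Injective (algebraMap ℂ (E →L[ℂ] E) z - T) := by
    rw [injective_iff_map_eq_zero]
    intro v hv
    by_contra hv0
    refine hcon v hv0 ?_
    have : z • v - T v = 0 := by simpa [Algebra.algebraMap_eq_smul_one] using hv
    exact (sub_eq_zero.1 this).symm
  exact ⟨hinj, (LinearMap.injective_iff_surjective
    (f := (algebraMap ℂ (E →L[ℂ] E) z - T : E →L[ℂ] E).toLinearMap)).1 hinj⟩

/-- The generalized eigenspaces over a set of scalars and over its complement are complementary. -/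
theorem isCompl_iSup_maxGenEigenspace {E : Type*} [AddCommGroup E] [Module ℂ E]
    [FiniteDimensional ℂ E] (f : Module.End ℂ E) (s : Set ℂ) :
    IsCompl (⨆ μ ∈ s, f.maxGenEigenspace μ) (⨆ μ ∈ sᶜ, f.maxGenEigenspace μ) := by
  constructor
  · exact f.independent_maxGenEigenspace.disjoint_biSup_biSup disjoint_compl_right
  · rw [codisjoint_iff, ← iSup_union, Set.union_compl_self, iSup_univ,
      Module.End.iSup_maxGenEigenspace_eq_top]

/-- Spectral splitting of an operator without eigenvalues on `{0} ∪ {|z| = 1}`. -/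
theorem exists_hyperbolic_splitting {E : Type*} [NormedAddCommGroup E] [NormedSpace ℂ E]
    [FiniteDimensional ℂ E] (A : E →L[ℂ] E)
    (hA : ∀ (μ : ℂ) (v : E), v ≠ 0 → A v = μ • v → ‖μ‖ ≠ 0 ∧ ‖μ‖ ≠ 1) :
    ∃ B P : E →L[ℂ] E, A * B = 1 ∧ B * A = 1 ∧ Commute P A ∧ P * P = P ∧
      (∃ C ρ : ℝ, 0 ≤ C ∧ 0 < ρ ∧ ρ < 1 ∧ ∀ n : ℕ, ‖(A * P) ^ n‖ ≤ C * ρ ^ n) ∧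
      (∃ C ρ : ℝ, 0 ≤ C ∧ 0 < ρ ∧ ρ < 1 ∧ ∀ n : ℕ, ‖(B * (1 - P)) ^ n‖ ≤ C * ρ ^ n) := by
  have := FiniteDimensional.complete ℂ E
  have hunit : IsUnit A := by
    by_contra h
    obtain ⟨v, hv, hv'⟩ := exists_eigenvector_of_mem_spectrum A (spectrum.zero_mem ℂ h)
    simpa using (hA 0 v hv hv').1
  obtain ⟨B, hAB, hBA⟩ := isUnit_iff_exists.1 hunit
  let f : Module.End ℂ E := A.toLinearMap
  let s : Set ℂ := {z | ‖z‖ < 1}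
  let p := ⨆ μ ∈ s, f.maxGenEigenspace μ
  let q := ⨆ μ ∈ sᶜ, f.maxGenEigenspace μ
  have hpq : IsCompl p q := isCompl_iSup_maxGenEigenspace f s
  have hinv : ∀ t : Set ℂ, (⨆ μ ∈ t, f.maxGenEigenspace μ) ∈ Module.End.invtSubmodule f := by
    intro t
    rw [Module.End.mem_invtSubmodule]
    refine iSup₂_le fun μ hμ x hx => ?_
    exact Submodule.mem_iSup_of_mem μ (Submodule.mem_iSup_of_mem hμ
      (Module.End.mapsTo_maxGenEigenspace_of_comm (Commute.refl f) μ hx))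
  have hmem : ∀ (t : Set ℂ) (μ : ℂ) (v : E), μ ∈ t → A v = μ • v →
      v ∈ ⨆ μ ∈ t, f.maxGenEigenspace μ := by
    intro t μ v hμ hv
    refine Submodule.mem_iSup_of_mem μ (Submodule.mem_iSup_of_mem hμ ?_)
    refine (f.genEigenspace μ).monotone (show (1 : ℕ∞) ≤ ⊤ from le_top) ?_
    exact Module.End.mem_eigenspace_iff.2 hv
  let P' : E →ₗ[ℂ] E := p.projection q hpq
  have hid : IsIdempotentElem P' := Submodule.isIdempotentElem_projection hpq
  have hcomm : Commute P' f := by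
    rw [LinearMap.IsIdempotentElem.commute_iff hid]
    simp only [P', Submodule.range_projection, Submodule.ker_projection]
    exact ⟨hinv s, hinv sᶜ⟩
  let P : E →L[ℂ] E := LinearMap.toContinuousLinearMap P'
  have hPA : ∀ v, P (A v) = A (P v) := fun v => LinearMap.congr_fun hcomm v
  have hPP : ∀ v, P (P v) = P v := fun v => LinearMap.congr_fun hid v
  have hPA' : Commute P A := ContinuousLinearMap.ext hPA
  have hPP' : P * P = P := ContinuousLinearMap.ext hPP
  have hPp : ∀ v, P v = v → v ∈ p := fun v hv => by
    rw [← hv]; exact Submodule.projection_apply_mem hpq v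
  have hPq : ∀ v, P v = 0 → v ∈ q := fun v hv => by
    have : v ∈ LinearMap.ker P' := hv
    rwa [Submodule.ker_projection] at this
  have hAB' : ∀ v, A (B v) = v := fun v => congr($hAB v)
  have hBA' : ∀ v, B (A v) = v := fun v => congr($hBA v)
  have hPB : ∀ v, P (B v) = B (P v) := fun v => by
    rw [← hBA' (P (B v)), ← hPA, hAB']
  refine ⟨B, P, hAB, hBA, hPA', hPP', ?_, ?_⟩
  · refine exists_norm_pow_le_geometric _ fun z hz => ?_
    obtain ⟨v, hv, hzv⟩ := exists_eigenvector_of_mem_spectrum _ hz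
    by_contra hz1
    -- A nonzero eigenvalue of `A * P` has its eigenvector in the range `p`; were `1 ≤ ‖z‖`, the
    -- vector would also lie in `q`.
    have hz0 : z ≠ 0 := by rintro rfl; simp at hz1
    have hzv' : A (P v) = z • v := hzv
    have hPv : P v = v := by
      have h1 : P (z • v) = z • v := by rw [← hzv', hPA, hPP]
      rw [map_smul] at h1
      exact smul_right_injective E hz0 h1
    have hvp := hPp v hPv
    rw [hPv] at hzv'
    have hvq : v ∈ q := hmem sᶜ z v hz1 hzv'
    exact hv (Submodule.disjoint_def.1 hpq.disjoint v hvp hvq)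
  · refine exists_norm_pow_le_geometric _ fun z hz => ?_
    obtain ⟨v, hv, hzv⟩ := exists_eigenvector_of_mem_spectrum _ hz
    by_contra hz1
    have hz0 : z ≠ 0 := by rintro rfl; simp at hz1
    have hzv' : B (v - P v) = z • v := hzv
    have hPv : P v = 0 := by
      have h1 : P (z • v) = 0 := by rw [← hzv', hPB, map_sub, hPP, sub_self, map_zero]
      rw [map_smul] at h1
      exact (smul_eq_zero.1 h1).resolve_left hz0
    have hvq := hPq v hPv
    rw [hPv, sub_zero] at hzv'
    have hAv : A v = z⁻¹ • v := by
      have h2 : v = z • A v := by rw [← map_smul, ← hzv', hAB']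
      rw [eq_inv_smul_iff₀ hz0]; exact h2.symm
    -- The only use of the exclusion of modulus one: `‖z⁻¹‖ ≤ 1` becomes strict, which puts `v` in
    -- `p` as well as in `q`.
    have hne := (hA _ v hv hAv).2
    rw [norm_inv] at hne
    have hlt : ‖z⁻¹‖ < 1 := by
      rw [norm_inv]
      refine lt_of_le_of_ne (inv_le_one_of_one_le₀ (not_lt.1 hz1)) hne
    exact hv (Submodule.disjoint_def.1 hpq.disjoint v (hmem s _ v hlt hAv) hvq)

/-! ### Boundedness in probability -/

/-- A family of random vectors is uniformly tight (bounded in probability). -/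
def UniformlyTight {Ω ι E : Type*} [MeasurableSpace Ω] [Norm E] (P : Measure Ω)
    (X : ι → Ω → E) : Prop :=
  ∀ ε : ENNReal, 0 < ε → ∃ K : ℝ, ∀ t, P {ω | K < ‖X t ω‖} ≤ ε

section Tightness

variable {Ω ι E F : Type*} [MeasurableSpace Ω] {P : Measure Ω}
  [NormedAddCommGroup E] [NormedAddCommGroup F]

theorem UniformlyTight.reindex {κ : Type*} {X : ι → Ω → E} (hX : UniformlyTight P X)
    (s : κ → ι) : UniformlyTight P (fun k => X (s k)) := fun ε hε =>
  (hX ε hε).imp fun _ hK k => hK (s k)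

theorem UniformlyTight.of_norm_le {X : ι → Ω → E} {Y : ι → Ω → F} (hX : UniformlyTight P X)
    (c : ℝ) (hc : 0 ≤ c) (h : ∀ t ω, ‖Y t ω‖ ≤ c * ‖X t ω‖) : UniformlyTight P Y := by
  intro ε hε
  obtain ⟨K, hK⟩ := hX ε hε
  refine ⟨c * K, fun t => (measure_mono fun ω hω => ?_).trans (hK t)⟩
  by_contra hcon
  exact absurd ((h t ω).trans (mul_le_mul_of_nonneg_left (not_lt.1 hcon) hc)) (not_le.2 hω)

theorem UniformlyTight.add {X Y : ι → Ω → E} (hX : UniformlyTight P X)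
    (hY : UniformlyTight P Y) : UniformlyTight P (fun t ω => X t ω + Y t ω) := by
  intro ε hε
  obtain ⟨K, hK⟩ := hX (ε / 2) (ENNReal.half_pos hε.ne')
  obtain ⟨L, hL⟩ := hY (ε / 2) (ENNReal.half_pos hε.ne')
  refine ⟨K + L, fun t => ?_⟩
  calc P {ω | K + L < ‖X t ω + Y t ω‖}
      ≤ P ({ω | K < ‖X t ω‖} ∪ {ω | L < ‖Y t ω‖}) := measure_mono fun ω hω => by
        by_contra hcon
        simp only [Set.mem_union, Set.mem_ofPred_eq, not_or, not_lt] at hcon hω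
        linarith [norm_add_le (X t ω) (Y t ω)]
    _ ≤ ε / 2 + ε / 2 := (measure_union_le _ _).trans (add_le_add (hK t) (hL t))
    _ = ε := ENNReal.add_halves ε

theorem UniformlyTight.zero : UniformlyTight P (fun (_ : ι) (_ : Ω) => (0 : E)) :=
  fun ε _ => ⟨0, fun _ => by simp⟩

theorem UniformlyTight.sum {κ : Type*} (s : Finset κ) {X : κ → ι → Ω → E}
    (hX : ∀ k ∈ s, UniformlyTight P (X k)) :
    UniformlyTight P (fun t ω => ∑ k ∈ s, X k t ω) := by
  classical
  induction s using Finset.induction_on with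
  | empty => simpa using UniformlyTight.zero
  | insert k s hk ih =>
    simp only [Finset.sum_insert hk]
    exact (hX k (Finset.mem_insert_self k s)).add
      (ih fun j hj => hX j (Finset.mem_insert_of_mem hj))

theorem UniformlyTight.clm [NormedSpace ℂ E] [NormedSpace ℂ F] {X : ι → Ω → E}
    (hX : UniformlyTight P X) (T : E →L[ℂ] F) : UniformlyTight P (fun t ω => T (X t ω)) :=
  hX.of_norm_le ‖T‖ (norm_nonneg _) fun _ _ => T.le_opNorm _

-- The events `n < ‖X₀‖` decrease to the empty set, so one law is tight; the bound depends on the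
-- law alone.
open Filter Topology in
theorem UniformlyTight.of_map_eq [IsFiniteMeasure P] [MeasurableSpace E] [BorelSpace E]
    {X : ι → Ω → E} {X₀ : Ω → E} (hX₀ : Measurable X₀) (hX : ∀ t, Measurable (X t))
    (h : ∀ t, P.map (X t) = P.map X₀) : UniformlyTight P X := by
  intro ε hε
  have hmeas : ∀ K : ℝ, MeasurableSet {x : E | K < ‖x‖} := fun K =>
    measurableSet_lt measurable_const measurable_norm
  have hlim : Tendsto (fun n : ℕ => P {ω | (n : ℝ) < ‖X₀ ω‖}) atTop
      (𝓝 (P (⋂ n : ℕ, {ω | (n : ℝ) < ‖X₀ ω‖}))) := by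
    refine tendsto_measure_iInter_atTop
      (fun n => ((hmeas n).preimage hX₀).nullMeasurableSet) ?_ ⟨0, measure_ne_top _ _⟩
    intro m n hmn ω hω
    exact lt_of_le_of_lt (by exact_mod_cast hmn) (show (n : ℝ) < ‖X₀ ω‖ from hω)
  have hempty : (⋂ n : ℕ, {ω | (n : ℝ) < ‖X₀ ω‖}) = ∅ := by
    refine Set.eq_empty_of_forall_notMem fun ω hω => ?_
    obtain ⟨n, hn⟩ := exists_nat_gt ‖X₀ ω‖
    exact absurd (Set.mem_iInter.1 hω n) (not_lt.2 hn.le)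
  rw [hempty, measure_empty] at hlim
  obtain ⟨n, hn⟩ := (hlim.eventually_le_const hε).exists
  refine ⟨n, fun t => ?_⟩
  have h1 := congrArg (fun μ => μ {x : E | (n : ℝ) < ‖x‖}) (h t)
  simp only [Measure.map_apply (hX t) (hmeas n), Measure.map_apply hX₀ (hmeas n)] at h1
  exact h1.trans_le hn

end Tightness

/-! ### Ottaviani's inequality and summable tails -/

section Maximal

variable {Ω E : Type*} [MeasurableSpace Ω] {P : Measure Ω} [IsProbabilityMeasure P]
  [NormedAddCommGroup E] [MeasurableSpace E] [BorelSpace E] [SecondCountableTopology E]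

/-- Ottaviani's maximal inequality, with the numerical constants `1/4` and `1/2`. -/
theorem measure_exists_norm_sum_gt_le {ξ : ℕ → Ω → E} (hm : ∀ j, Measurable (ξ j))
    (hi : iIndepFun ξ P) (a : ℝ) (n : ℕ)
    (h : ∀ k ≤ n, P {ω | a < ‖∑ j ∈ Finset.Ico k n, ξ j ω‖} ≤ 1 / 4) :
    P {ω | ∃ k ≤ n, 2 * a < ‖∑ j ∈ Finset.range k, ξ j ω‖} ≤ 1 / 2 := by
  set S : ℕ → Ω → E := fun k ω => ∑ j ∈ Finset.range k, ξ j ω with hS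
  -- `D k`: the level `2 * a` is first exceeded at time `k`. `G k`: the increment from `k` to `n` is
  -- large.
  let D : ℕ → Set Ω := fun k => {ω | 2 * a < ‖S k ω‖ ∧ ∀ j < k, ‖S j ω‖ ≤ 2 * a}
  let G : ℕ → Set Ω := fun k => {ω | a < ‖∑ j ∈ Finset.Ico k n, ξ j ω‖}
  set U : Set Ω := {ω | ∃ k ≤ n, 2 * a < ‖∑ j ∈ Finset.range k, ξ j ω‖} with hU
  -- The σ-algebra is left free: it will be the ambient one, or the one generated by the terms
  -- before or from `k`.
  have hsum : ∀ (m : MeasurableSpace Ω) (s : Finset ℕ), (∀ j ∈ s, Measurable[m] (ξ j)) →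
      Measurable[m] (fun ω => ‖∑ j ∈ s, ξ j ω‖) := fun m s hs =>
    (Finset.measurable_fun_sum s hs).norm
  have hDm : ∀ (m : MeasurableSpace Ω) (k : ℕ), (∀ j < k, Measurable[m] (ξ j)) →
      MeasurableSet[m] (D k) := by
    intro m k hk
    have hSk : ∀ j ≤ k, Measurable[m] (fun ω => ‖S j ω‖) := fun j hj =>
      hsum m _ fun i hi => hk i ((Finset.mem_range.1 hi).trans_le hj)
    have : D k = {ω | 2 * a < ‖S k ω‖} ∩ ⋂ j : Fin k, {ω | ‖S j ω‖ ≤ 2 * a} := by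
      ext ω; simp [D, Fin.forall_iff]
    rw [this]
    exact (measurableSet_lt measurable_const (hSk k le_rfl)).inter
      (MeasurableSet.iInter fun j => measurableSet_le (hSk j j.2.le) measurable_const)
  have hind : ∀ k, P (D k ∩ G k) = P (D k) * P (G k) := by
    intro k
    have hle : ∀ j, MeasurableSpace.comap (ξ j) inferInstance ≤ ‹MeasurableSpace Ω› :=
      fun j => (hm j).comap_le
    have hI := indep_iSup_of_disjoint hle hi (S := {j | j < k}) (T := {j | k ≤ j})
      (Set.disjoint_left.2 fun j h1 h2 => absurd (show j < k from h1) (not_lt.2 h2))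
    have hcm : ∀ (s : Set ℕ) (j : ℕ), j ∈ s →
        Measurable[⨆ i ∈ s, MeasurableSpace.comap (ξ i) inferInstance] (ξ j) := fun s j hj =>
      (comap_measurable (ξ j)).mono
        (le_iSup₂ (f := fun i (_ : i ∈ s) => MeasurableSpace.comap (ξ i) inferInstance) j hj) le_rfl
    refine (Indep_iff _ _ _).1 hI _ _ (hDm _ k fun j hj => hcm {j | j < k} j hj) ?_
    exact measurableSet_lt measurable_const
      (hsum _ _ fun j hj => hcm {j | k ≤ j} j (Finset.mem_Ico.1 hj).1)
  have hUD : U = ⋃ k ∈ Finset.range (n + 1), D k := by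
    classical
    ext ω
    simp only [hU, Set.mem_ofPred_eq, Set.mem_iUnion, Finset.mem_range, exists_prop, D,
      Nat.lt_succ_iff]
    constructor
    · intro hex
      have hex' : ∃ k, 2 * a < ‖S k ω‖ := hex.imp fun _ h => h.2
      obtain ⟨k, hk, hk'⟩ := hex
      exact ⟨Nat.find hex', (Nat.find_min' hex' hk').trans hk, Nat.find_spec hex',
        fun j hj => not_lt.1 (Nat.find_min hex' hj)⟩
    · rintro ⟨k, hk, hk', -⟩
      exact ⟨k, hk, hk'⟩
  have hdisj : (Finset.range (n + 1) : Set ℕ).PairwiseDisjoint D := by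
    intro i _ j _ hij
    refine Set.disjoint_left.2 fun ω hωi hωj => ?_
    rcases lt_or_gt_of_ne hij with h1 | h1
    · exact absurd hωi.1 (not_lt.2 (hωj.2 i h1))
    · exact absurd hωj.1 (not_lt.2 (hωi.2 j h1))
  have hPU : P U = ∑ k ∈ Finset.range (n + 1), P (D k) := by
    rw [hUD, measure_biUnion_finset hdisj fun k _ => hDm _ k fun j _ => hm j]
  -- On `D k` outside `G k` the full sum still exceeds `2 * a - a`, which is the event `G 0`.
  have hcover : U ⊆ G 0 ∪ ⋃ k ∈ Finset.range (n + 1), D k ∩ G k := by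
    intro ω hω
    rw [hUD] at hω
    simp only [Set.mem_iUnion, exists_prop] at hω
    obtain ⟨k, hk, hωk⟩ := hω
    by_cases hG : ω ∈ G k
    · exact Or.inr (Set.mem_biUnion hk ⟨hωk, hG⟩)
    · left
      have h1 : ‖∑ j ∈ Finset.Ico k n, ξ j ω‖ ≤ a := not_lt.1 hG
      have h2 : 2 * a < ‖S k ω‖ := hωk.1
      have h3 : S k ω = ∑ j ∈ Finset.range n, ξ j ω - ∑ j ∈ Finset.Ico k n, ξ j ω := by
        rw [Finset.sum_Ico_eq_sub _ (Nat.lt_succ_iff.1 (Finset.mem_range.1 hk))]; simp [hS]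
      have h4 := norm_sub_le (∑ j ∈ Finset.range n, ξ j ω) (∑ j ∈ Finset.Ico k n, ξ j ω)
      rw [← h3] at h4
      show a < ‖∑ j ∈ Finset.Ico 0 n, ξ j ω‖
      rw [← Finset.range_eq_Ico]
      linarith
  -- This gives `P U ≤ 1 / 3`, more than enough.
  have hmain : P U ≤ 1 / 4 + P U * (1 / 4) := by
    calc P U ≤ P (G 0) + ∑ k ∈ Finset.range (n + 1), P (D k ∩ G k) :=
          (measure_mono hcover).trans ((measure_union_le _ _).trans
            (by gcongr; exact measure_biUnion_finset_le _ _))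
      _ ≤ 1 / 4 + ∑ k ∈ Finset.range (n + 1), P (D k) * (1 / 4) := by
          gcongr with k hk
          · exact h 0 (Nat.zero_le n)
          · rw [hind]
            gcongr
            exact h k (Nat.lt_succ_iff.1 (Finset.mem_range.1 hk))
      _ = 1 / 4 + P U * (1 / 4) := by rw [hPU, Finset.sum_mul]
  have hfin : P U ≠ ⊤ := measure_ne_top _ _
  rw [← ENNReal.toReal_le_toReal hfin (by finiteness)] at hmain ⊢
  rw [ENNReal.toReal_add (by finiteness) (by finiteness), ENNReal.toReal_mul] at hmain
  simp only [ENNReal.toReal_div, ENNReal.toReal_one, ENNReal.toReal_ofNat] at hmain ⊢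
  linarith

open Filter Topology in
/-- If the partial sums of an independent sequence are bounded in probability,
then the terms are almost surely bounded, in the quantitative Borel-Cantelli sense. -/
theorem tsum_measure_norm_gt_ne_top {ξ : ℕ → Ω → E} (hm : ∀ j, Measurable (ξ j))
    (hi : iIndepFun ξ P) (a : ℝ)
    (h : ∀ n, ∀ k ≤ n, P {ω | a < ‖∑ j ∈ Finset.Ico k n, ξ j ω‖} ≤ 1 / 4) :
    ∑' j, P {ω | 4 * a < ‖ξ j ω‖} ≠ ⊤ := by
  intro htop
  let s : ℕ → Set Ω := fun j => {ω | 4 * a < ‖ξ j ω‖}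
  have hE : MeasurableSet {x : E | 4 * a < ‖x‖} := measurableSet_lt measurable_const measurable_norm
  have hsm : ∀ j, MeasurableSet (s j) := fun j => hE.preimage (hm j)
  have hs : iIndepSet s P := by
    rw [iIndepSet_iff_meas_biInter hsm]
    intro t
    exact hi.measure_inter_preimage_eq_mul t (fun _ _ => hE)
  -- Divergence would make large terms occur almost surely. A term above `4 * a` forces one of two
  -- consecutive partial sums above `2 * a`, an event of probability at most `1 / 2`.
  have hone := measure_limsup_eq_one hsm hs htop
  let V : ℕ → Set Ω := fun n => {ω | ∃ k ≤ n, 2 * a < ‖∑ j ∈ Finset.range k, ξ j ω‖}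
  have hV : Monotone V := fun m n hmn ω ⟨k, hk, hk'⟩ => ⟨k, hk.trans hmn, hk'⟩
  have hsub : limsup s atTop ⊆ ⋃ n, V n := by
    intro ω hω
    rw [mem_limsup_iff_frequently_mem] at hω
    obtain ⟨j, hj⟩ := hω.exists
    have hj' : 4 * a < ‖ξ j ω‖ := hj
    have h1 : ξ j ω = ∑ i ∈ Finset.range (j + 1), ξ i ω - ∑ i ∈ Finset.range j, ξ i ω := by
      rw [Finset.sum_range_succ]; abel
    have h2 := norm_sub_le (∑ i ∈ Finset.range (j + 1), ξ i ω) (∑ i ∈ Finset.range j, ξ i ω)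
    rw [← h1] at h2
    refine Set.mem_iUnion.2 ⟨j + 1, ?_⟩
    by_contra hcon
    simp only [V, Set.mem_ofPred_eq, not_exists, not_and, not_lt] at hcon
    linarith [hcon (j + 1) le_rfl, hcon j (Nat.le_succ j)]
  have hle : P (⋃ n, V n) ≤ 1 / 2 := by
    rw [hV.measure_iUnion]
    exact iSup_le fun n => measure_exists_norm_sum_gt_le hm hi a n (h n)
  have hcontra : (1 : ENNReal) ≤ 1 / 2 := hone.symm.trans_le ((measure_mono hsub).trans hle)
  exact absurd hcontra (not_le.2 (by simp))

end Maximal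

/-! ### Logarithmic moments -/

section LogMoment

variable {Ω : Type*} [MeasurableSpace Ω] {P : Measure Ω}

/-- Summable tails along an arithmetic progression give a finite first moment. -/
theorem lintegral_ofReal_lt_top_of_tsum {X : Ω → ℝ} (hX : Measurable X) {α : ℝ} (hα : 0 < α)
    (h : ∑' n : ℕ, P {ω | α * n < X ω} ≠ ⊤) : ∫⁻ ω, ENNReal.ofReal (X ω) ∂P < ⊤ := by
  have hm : ∀ n : ℕ, MeasurableSet {ω | α * n < X ω} := fun n =>
    measurableSet_lt measurable_const hX
  -- The positive part of `X` is at most `α` times the number of `n` with `α * n < X`.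
  have hpt : ∀ ω, ENNReal.ofReal (X ω) ≤
      ∑' n : ℕ, {ω | α * n < X ω}.indicator (fun _ => ENNReal.ofReal α) ω := by
    intro ω
    calc ENNReal.ofReal (X ω) ≤ ENNReal.ofReal (⌈X ω / α⌉₊ * α) :=
          ENNReal.ofReal_le_ofReal ((div_le_iff₀ hα).1 (Nat.le_ceil _))
      _ = ∑ n ∈ Finset.range ⌈X ω / α⌉₊, ENNReal.ofReal α := by
          rw [Finset.sum_const, Finset.card_range, nsmul_eq_mul,
            ENNReal.ofReal_mul (Nat.cast_nonneg _), ENNReal.ofReal_natCast]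
      _ = ∑ n ∈ Finset.range ⌈X ω / α⌉₊,
          {ω | α * n < X ω}.indicator (fun _ => ENNReal.ofReal α) ω := by
          refine Finset.sum_congr rfl fun n hn => ?_
          rw [Set.indicator_of_mem]
          have := Nat.lt_ceil.1 (Finset.mem_range.1 hn)
          rw [lt_div_iff₀ hα] at this
          show α * n < X ω
          linarith
      _ ≤ _ := ENNReal.sum_le_tsum _
  calc ∫⁻ ω, ENNReal.ofReal (X ω) ∂P
      ≤ ∫⁻ ω, ∑' n : ℕ, {ω | α * n < X ω}.indicator (fun _ => ENNReal.ofReal α) ω ∂P :=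
        lintegral_mono hpt
    _ = ∑' n : ℕ, ENNReal.ofReal α * P {ω | α * n < X ω} := by
        rw [lintegral_tsum fun n => (measurable_const.indicator (hm n)).aemeasurable]
        exact tsum_congr fun n => lintegral_indicator_const (hm n) _
    _ = ENNReal.ofReal α * ∑' n : ℕ, P {ω | α * n < X ω} := ENNReal.tsum_mul_left
    _ < ⊤ := ENNReal.mul_lt_top ENNReal.ofReal_lt_top (lt_top_iff_ne_top.2 h)

theorem lintegral_posLog_lt_top_of_le [IsFiniteMeasure P] {u v : Ω → ℝ} (hu : ∀ ω, 0 ≤ u ω)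
    (c : ℝ) (h : ∀ ω, u ω ≤ c * v ω)
    (hv : ∫⁻ ω, ENNReal.ofReal (Real.posLog (v ω)) ∂P < ⊤) :
    ∫⁻ ω, ENNReal.ofReal (Real.posLog (u ω)) ∂P < ⊤ := by
  calc ∫⁻ ω, ENNReal.ofReal (Real.posLog (u ω)) ∂P
      ≤ ∫⁻ ω, (ENNReal.ofReal (Real.posLog c) + ENNReal.ofReal (Real.posLog (v ω))) ∂P := by
        refine lintegral_mono fun ω => ?_
        rw [← ENNReal.ofReal_add Real.posLog_nonneg Real.posLog_nonneg]
        exact ENNReal.ofReal_le_ofReal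
          ((Real.posLog_le_posLog (hu ω) (h ω)).trans Real.posLog_mul)
    _ = ENNReal.ofReal (Real.posLog c) * P Set.univ
        + ∫⁻ ω, ENNReal.ofReal (Real.posLog (v ω)) ∂P := by
        rw [lintegral_add_left measurable_const, lintegral_const]
    _ < ⊤ := ENNReal.add_lt_top.2
        ⟨ENNReal.mul_lt_top ENNReal.ofReal_lt_top (measure_lt_top _ _), hv⟩

/-- Summable geometric tails give a finite logarithmic moment. -/
theorem lintegral_posLog_lt_top_of_tsum [IsFiniteMeasure P] {X : Ω → ℝ} (hX : Measurable X)
    (hX0 : ∀ ω, 0 ≤ X ω) {a σ : ℝ} (ha : 0 < a) (hσ : 0 < σ) (hσ1 : σ < 1)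
    (h : ∑' n : ℕ, P {ω | a < σ ^ n * X ω} ≠ ⊤) :
    ∫⁻ ω, ENNReal.ofReal (Real.posLog (X ω)) ∂P < ⊤ := by
  have hpm : Measurable fun ω => Real.posLog (X ω) :=
    Real.continuous_posLog.measurable.comp hX
  have hlσ : 0 < -Real.log σ := by linarith [Real.log_neg hσ hσ1]
  -- Taking logarithms turns geometric tails into arithmetic ones of step `-log σ`. Since `log a ≤
  -- posLog a`, using `posLog a` only shrinks the events.
  have key : ∫⁻ ω, ENNReal.ofReal (Real.posLog (X ω) - Real.posLog a) ∂P < ⊤ := by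
    refine lintegral_ofReal_lt_top_of_tsum (α := -Real.log σ) (hpm.sub measurable_const) hlσ
      (ne_top_of_le_ne_top h (ENNReal.tsum_le_tsum fun n => measure_mono fun ω hω => ?_))
    have hω' : -Real.log σ * n < Real.posLog (X ω) - Real.posLog a := hω
    have h0 : 0 ≤ -Real.log σ * n := by positivity
    have hpos : 0 < Real.posLog (X ω) := by linarith [Real.posLog_nonneg (x := a)]
    have h1 : 1 ≤ |X ω| := by
      by_contra hcon
      rw [(Real.posLog_eq_zero_iff _).2 (not_le.1 hcon).le] at hpos
      exact lt_irrefl _ hpos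
    have hla : Real.log a ≤ Real.posLog a := le_max_right _ _
    rw [Real.posLog_eq_log h1] at hω'
    rw [abs_of_nonneg (hX0 ω)] at h1
    have hX1 : 0 < X ω := by linarith
    have : Real.log a < Real.log (σ ^ n * X ω) := by
      rw [Real.log_mul (by positivity) hX1.ne', Real.log_pow]
      linarith
    exact (Real.log_lt_log_iff ha (by positivity)).1 this
  calc ∫⁻ ω, ENNReal.ofReal (Real.posLog (X ω)) ∂P
      ≤ ∫⁻ ω, (ENNReal.ofReal (Real.posLog a)
          + ENNReal.ofReal (Real.posLog (X ω) - Real.posLog a)) ∂P := by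
        refine lintegral_mono fun ω => ?_
        refine le_trans (le_of_eq ?_) ENNReal.ofReal_add_le
        congr 1; ring
    _ = ENNReal.ofReal (Real.posLog a) * P Set.univ
        + ∫⁻ ω, ENNReal.ofReal (Real.posLog (X ω) - Real.posLog a) ∂P := by
        rw [lintegral_add_left measurable_const, lintegral_const]
    _ < ⊤ := ENNReal.add_lt_top.2
        ⟨ENNReal.mul_lt_top ENNReal.ofReal_lt_top (measure_lt_top _ _), key⟩

end LogMoment

/-! ### Necessity and sufficiency for one contracting recursion -/

section Autoregression

variable {Ω E : Type*} [MeasurableSpace Ω] {P : Measure Ω} [IsProbabilityMeasure P]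
  [NormedAddCommGroup E] [NormedSpace ℂ E] [MeasurableSpace E] [BorelSpace E]
  [SecondCountableTopology E]

/-- A bounded-in-probability solution of `W t = T (W (t - 1)) + ζ t` forces the noise to have a
finite logarithmic moment. -/
theorem lintegral_posLog_lt_top_of_uniformlyTight (T : E →L[ℂ] E) {C σ : ℝ} (hC : 0 ≤ C)
    (hT : ∀ n : ℕ, ‖T ^ n‖ ≤ C) (hσ : 0 < σ) (hσ1 : σ < 1)
    {ζ W : ℤ → Ω → E} (hm : ∀ t, Measurable (ζ t)) (hi : iIndepFun ζ P)
    (hid : ∀ t, IdentDistrib (ζ t) (ζ 0) P P)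
    (hlow : ∀ (n : ℕ) (t : ℤ) (ω : Ω), σ ^ n * ‖ζ t ω‖ ≤ ‖(T ^ n) (ζ t ω)‖)
    (hW : UniformlyTight P W) (hrec : ∀ᵐ ω ∂P, ∀ t, W t ω = T (W (t - 1) ω) + ζ t ω) :
    ∫⁻ ω, ENNReal.ofReal (Real.posLog ‖ζ 0 ω‖) ∂P < ⊤ := by
  let ξ : ℕ → Ω → E := fun j ω => (T ^ j) (ζ (-(j : ℤ)) ω)
  have hξm : ∀ j, Measurable (ξ j) := fun j => (T ^ j).continuous.measurable.comp (hm _)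
  have hξi : iIndepFun ξ P :=
    (hi.precomp (g := fun j : ℕ => -(j : ℤ)) (fun i j hij => by simpa using hij)).comp
      (fun j => T ^ j) (fun j => (T ^ j).continuous.measurable)
  have htight : UniformlyTight P fun (n : ℕ) ω => (T ^ n) (W (-(n : ℤ)) ω) :=
    (hW.reindex fun n : ℕ => -(n : ℤ)).of_norm_le C hC fun n ω =>
      ((T ^ n).le_opNorm _).trans (by gcongr; exact hT n)
  -- A block sum is a difference of two such terms, so `1 / 8` each gives the `1 / 4` of the maximal
  -- inequality; likewise `a` is at least `2 * K`.
  obtain ⟨K, hK⟩ := htight (1 / 8) (by simp)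
  set a : ℝ := 2 * max K 1 with ha
  have hapos : 0 < a := by have := le_max_right K 1; linarith
  have hpartial : ∀ᵐ ω ∂P, ∀ n, ∀ k ≤ n, ∑ j ∈ Finset.Ico k n, ξ j ω =
      (T ^ k) (W (-(k : ℤ)) ω) - (T ^ n) (W (-(n : ℤ)) ω) := by
    filter_upwards [hrec] with ω hω n k hkn
    induction n, hkn using Nat.le_induction with
    | base => simp
    | succ n hkn ih =>
      rw [Finset.sum_Ico_succ_top hkn, ih, hω (-(n : ℤ)), map_add, pow_succ,
        mul_apply_eq_comp]
      have : -((n + 1 : ℕ) : ℤ) = -(n : ℤ) - 1 := by push_cast; ring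
      rw [this]
      simp only [ξ]
      abel
  have hbound : ∀ n, ∀ k ≤ n, P {ω | a < ‖∑ j ∈ Finset.Ico k n, ξ j ω‖} ≤ 1 / 4 := by
    intro n k hkn
    calc P {ω | a < ‖∑ j ∈ Finset.Ico k n, ξ j ω‖}
        ≤ P ({ω | K < ‖(T ^ k) (W (-(k : ℤ)) ω)‖} ∪ {ω | K < ‖(T ^ n) (W (-(n : ℤ)) ω)‖}) := by
          refine measure_mono_ae ?_
          filter_upwards [hpartial] with ω hω hlt
          have hlt' : a < ‖∑ j ∈ Finset.Ico k n, ξ j ω‖ := hlt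
          rw [hω n k hkn] at hlt'
          by_contra hcon
          have hcon' : ‖(T ^ k) (W (-(k : ℤ)) ω)‖ ≤ K ∧ ‖(T ^ n) (W (-(n : ℤ)) ω)‖ ≤ K := by
            constructor
            · by_contra h; exact hcon (Or.inl (not_le.1 h))
            · by_contra h; exact hcon (Or.inr (not_le.1 h))
          have := norm_sub_le ((T ^ k) (W (-(k : ℤ)) ω)) ((T ^ n) (W (-(n : ℤ)) ω))
          linarith [hcon'.1, hcon'.2, le_max_left K 1]
      _ ≤ 1 / 8 + 1 / 8 := (measure_union_le _ _).trans (add_le_add (hK k) (hK n))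
      _ = 1 / 4 := by
          rw [← ENNReal.toReal_eq_toReal_iff' (by finiteness) (by finiteness),
            ENNReal.toReal_add (by finiteness) (by finiteness)]
          norm_num
  have htsum := tsum_measure_norm_gt_ne_top hξm hξi a hbound
  refine lintegral_posLog_lt_top_of_tsum (hm 0).norm (fun _ => norm_nonneg _)
    (a := 4 * a) (by positivity) hσ hσ1 (ne_top_of_le_ne_top htsum
      (ENNReal.tsum_le_tsum fun n => ?_))
  have hset : MeasurableSet {x : E | 4 * a < σ ^ n * ‖x‖} :=
    measurableSet_lt measurable_const (measurable_const.mul measurable_norm)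
  calc P {ω | 4 * a < σ ^ n * ‖ζ 0 ω‖} = P {ω | 4 * a < σ ^ n * ‖ζ (-(n : ℤ)) ω‖} :=
        ((hid (-(n : ℤ))).measure_mem_eq hset).symm
    _ ≤ _ := measure_mono fun ω hω => lt_of_lt_of_le hω (hlow n _ ω)

omit [SecondCountableTopology E] in
open Filter Topology in
/-- Geometrically weighted series of identically distributed vectors with finite logarithmic
moment converge almost surely. -/
theorem ae_summable_pow_apply [CompleteSpace E] (T : E →L[ℂ] E) {C ρ : ℝ} (hρ : 0 < ρ) (hρ1 : ρ < 1)
    (hT : ∀ n : ℕ, ‖T ^ n‖ ≤ C * ρ ^ n) {ζ : ℕ → Ω → E} {ζ₀ : Ω → E}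
    (hid : ∀ n, IdentDistrib (ζ n) ζ₀ P P)
    (hlog : ∫⁻ ω, ENNReal.ofReal (Real.posLog ‖ζ₀ ω‖) ∂P < ⊤) :
    ∀ᵐ ω ∂P, Summable fun n => (T ^ n) (ζ n ω) := by
  have hC : 0 ≤ C := by simpa using (norm_nonneg _).trans (hT 0)
  -- With this choice `ρ * exp ε` is the square root of `ρ`, still below one.
  set ε : ℝ := -Real.log ρ / 2 with hε
  have hlogρ : Real.log ρ < 0 := Real.log_neg hρ hρ1
  have hεpos : 0 < ε := by rw [hε]; linarith
  let X : Ω → ℝ := fun ω => Real.posLog ‖ζ₀ ω‖ / ε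
  have hpm : AEMeasurable (fun ω => Real.posLog ‖ζ₀ ω‖) P :=
    Real.continuous_posLog.measurable.comp_aemeasurable (hid 0).aemeasurable_snd.norm
  have hint : Integrable X P := by
    refine Integrable.div_const ⟨hpm.aestronglyMeasurable, ?_⟩ ε
    rw [hasFiniteIntegral_iff_ofReal (Eventually.of_forall fun _ => Real.posLog_nonneg)]
    exact hlog
  have hsum : ∑' n : ℕ, P {ω | X ω ∈ Set.Ioi (n : ℝ)} < ⊤ := by
    let : MeasureSpace Ω := ⟨P⟩
    exact tsum_prob_mem_Ioi_lt_top hint fun ω => div_nonneg Real.posLog_nonneg hεpos.le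
  have hset : ∀ n : ℕ, MeasurableSet {x : E | (n : ℝ) < Real.posLog ‖x‖ / ε} := fun n =>
    measurableSet_lt measurable_const
      ((Real.continuous_posLog.measurable.comp measurable_norm).div_const ε)
  have hsum' : ∑' n : ℕ, P {ω | (n : ℝ) < Real.posLog ‖ζ n ω‖ / ε} ≠ ⊤ := by
    refine ne_of_lt (lt_of_le_of_lt (ENNReal.tsum_le_tsum fun n => ?_) hsum)
    exact ((hid n).measure_mem_eq (hset n)).le
  filter_upwards [ae_eventually_notMem hsum'] with ω hω
  have hexp : ρ * Real.exp ε < 1 := by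
    rw [← Real.exp_log hρ, ← Real.exp_add, Real.exp_lt_one_iff, hε]
    linarith
  refine Summable.of_norm_bounded_eventually_nat
    (g := fun n => C * (ρ * Real.exp ε) ^ n)
    ((summable_geometric_of_lt_one (by positivity) hexp).mul_left C) ?_
  filter_upwards [hω] with n hn
  have h1 : Real.posLog ‖ζ n ω‖ ≤ n * ε := by
    rw [← div_le_iff₀ hεpos]
    exact not_lt.1 hn
  have h2 : ‖ζ n ω‖ ≤ Real.exp ε ^ n := by
    rcases (norm_nonneg (ζ n ω)).eq_or_lt with h0 | h0
    · rw [← h0]; positivity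
    · rw [← Real.exp_nat_mul, ← Real.log_le_iff_le_exp h0]
      exact (le_max_right _ _).trans h1
  calc ‖(T ^ n) (ζ n ω)‖ ≤ ‖T ^ n‖ * ‖ζ n ω‖ := (T ^ n).le_opNorm _
    _ ≤ (C * ρ ^ n) * Real.exp ε ^ n := by gcongr; exact hT n
    _ = C * (ρ * Real.exp ε) ^ n := by rw [mul_pow]; ring

end Autoregression

/-! ### The operator power series as a measurable functional -/

section Series

variable {E : Type*} [NormedAddCommGroup E] [NormedSpace ℂ E]

open Filter Topology in
/-- The limit of the partial sums of `∑ n, T ^ n (z n)`. -/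
noncomputable def powSeries (T : E →L[ℂ] E) (z : ℕ → E) : E :=
  limUnder atTop fun n => ∑ j ∈ Finset.range n, (T ^ j) (z j)

theorem powSeries_eq_tsum (T : E →L[ℂ] E) {z : ℕ → E} (hz : Summable fun n => (T ^ n) (z n)) :
    powSeries T z = ∑' n, (T ^ n) (z n) :=
  hz.hasSum.tendsto_sum_nat.limUnder_eq

theorem powSeries_eq_add (T : E →L[ℂ] E) {z : ℕ → E}
    (hz : Summable fun n => (T ^ n) (z n)) (hz' : Summable fun n => (T ^ n) (z (n + 1))) :
    powSeries T z = z 0 + T (powSeries T fun n => z (n + 1)) := by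
  rw [powSeries_eq_tsum T hz, powSeries_eq_tsum T hz', hz.tsum_eq_zero_add, T.map_tsum hz']
  simp [pow_succ']

/-- This is why `limUnder` is used: a limit of a sequence of measurable maps is measurable without
any convergence hypothesis. -/
theorem measurable_powSeries [CompleteSpace E] [MeasurableSpace E] [BorelSpace E]
    [SecondCountableTopology E] (T : E →L[ℂ] E) : Measurable (powSeries T) := by
  refine (StronglyMeasurable.limUnder fun n => Measurable.stronglyMeasurable ?_).measurable
  exact Finset.measurable_fun_sum _ fun j _ =>
    (T ^ j).continuous.measurable.comp (measurable_pi_apply j)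

end Series

/-! ### Equivalence of norms -/

section Norms

/-- Every norm on `ℂ^m` is equivalent to the sup norm. -/
theorem exists_seminorm_equiv {m : ℕ} (N : Seminorm ℂ (Fin m → ℂ)) (hN : ∀ x, N x = 0 → x = 0) :
    ∃ c : ℝ, ∀ x, N x ≤ c * ‖x‖ ∧ ‖x‖ ≤ c * N x := by
  set c₁ : ℝ := ∑ i, N (Pi.single i 1) with hc₁
  have hup : ∀ x, N x ≤ c₁ * ‖x‖ := by
    intro x
    have hx : x = ∑ i, x i • (Pi.single i 1 : Fin m → ℂ) := by
      ext j; simp [Finset.sum_apply, Pi.single_apply]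
    have hle : N x ≤ ∑ i, N (x i • (Pi.single i 1 : Fin m → ℂ)) := by
      conv_lhs => rw [hx]
      exact Finset.le_sum_of_subadditive N (map_zero N).le (fun x y => map_add_le_add N x y) _ _
    refine hle.trans ?_
    rw [hc₁, Finset.sum_mul]
    refine Finset.sum_le_sum fun i _ => ?_
    rw [map_smul_eq_mul, mul_comm]
    exact mul_le_mul_of_nonneg_left (norm_le_pi_norm x i) (apply_nonneg N _)
  have hcont : Continuous N := by
    refine Seminorm.continuous_of_continuousAt_zero ?_
    have h0 : Filter.Tendsto (fun x : Fin m → ℂ => c₁ * ‖x‖) (nhds 0) (nhds 0) :=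
      (continuous_const.mul continuous_norm).tendsto' _ _ (by simp)
    rw [ContinuousAt, map_zero]
    exact squeeze_zero (fun x => apply_nonneg N x) hup h0
  have hlow : ∃ c₂ : ℝ, ∀ x, ‖x‖ ≤ c₂ * N x := by
    -- The sphere is empty for `m = 0`; otherwise compactness gives `N` a positive minimum on it.
    rcases (Metric.sphere (0 : Fin m → ℂ) 1).eq_empty_or_nonempty with he | hne
    · refine ⟨0, fun x => ?_⟩
      by_contra hx
      have hx0 : x ≠ 0 := by rintro rfl; simp at hx
      have : ((‖x‖⁻¹ : ℝ) : ℂ) • x ∈ Metric.sphere (0 : Fin m → ℂ) 1 := by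
        simp [norm_smul, inv_mul_cancel₀ (norm_ne_zero_iff.2 hx0)]
      rw [he] at this
      exact this
    · obtain ⟨y, hy, hmin⟩ := (isCompact_sphere (0 : Fin m → ℂ) 1).exists_isMinOn hne
        hcont.continuousOn
      have hy1 : ‖y‖ = 1 := by simpa using hy
      have hNy : 0 < N y := lt_of_le_of_ne (apply_nonneg N y) fun h => by
        rw [hN y h.symm] at hy1; simp at hy1
      refine ⟨(N y)⁻¹, fun x => ?_⟩
      rcases eq_or_ne x 0 with rfl | hx0
      · simp
      · have hxn : 0 < ‖x‖ := norm_pos_iff.2 hx0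
        have hmem : ((‖x‖⁻¹ : ℝ) : ℂ) • x ∈ Metric.sphere (0 : Fin m → ℂ) 1 := by
          simp [norm_smul, inv_mul_cancel₀ hxn.ne']
        have h1 : N y ≤ N (((‖x‖⁻¹ : ℝ) : ℂ) • x) := hmin hmem
        rw [map_smul_eq_mul, Complex.norm_real, norm_inv, norm_norm, inv_mul_eq_div,
          le_div_iff₀ hxn] at h1
        rw [inv_mul_eq_div, le_div_iff₀ hNy]
        linarith
  obtain ⟨c₂, hc₂⟩ := hlow
  refine ⟨max c₁ c₂, fun x => ⟨(hup x).trans ?_, (hc₂ x).trans ?_⟩⟩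
  · exact mul_le_mul_of_nonneg_right (le_max_left _ _) (norm_nonneg _)
  · exact mul_le_mul_of_nonneg_right (le_max_right _ _) (apply_nonneg N _)

end Norms

/-! ### Stationarity of functionals of the noise -/

section Shift

variable {Ω : Type*} [MeasurableSpace Ω] {P : Measure Ω} {d : ℕ} {Z : ℤ → Ω → (Fin d → ℂ)}

/-- The law of an i.i.d. sequence is invariant under shifts. -/
theorem IsIIDSequence.map_shift (hZ : IsIIDSequence P Z) (h : ℤ) :
    P.map (fun ω k => Z (k + h) ω) = P.map (fun ω k => Z k ω) := by
  have hi : iIndepFun (fun k => Z (k + h)) P :=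
    hZ.indep.precomp (g := fun k : ℤ => k + h) (add_left_injective h)
  rw [hi.map_fun_eq_infinitePi_map fun k => hZ.measurable _,
    hZ.indep.map_fun_eq_infinitePi_map hZ.measurable]
  congr 1
  funext k
  rw [(hZ.identDistrib (k + h)).map_eq, (hZ.identDistrib k).map_eq]

/-- A measurable moving functional of an i.i.d. sequence is strictly stationary. -/
theorem IsIIDSequence.isStrictlyStationary (hZ : IsIIDSequence P Z) {m : ℕ}
    {H : (ℤ → Fin d → ℂ) → (Fin m → ℂ)} (hH : Measurable H) :
    IsStrictlyStationary P (fun t ω => H fun k => Z (t + k) ω) := by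
  have hshift : ∀ t : ℤ, Measurable fun (z : ℤ → Fin d → ℂ) k => z (t + k) := fun t =>
    measurable_pi_lambda _ fun k => measurable_pi_apply _
  have hZm : ∀ h : ℤ, Measurable fun ω k => Z (k + h) ω := fun h =>
    measurable_pi_lambda _ fun k => hZ.measurable _
  refine ⟨fun t => hH.comp (measurable_pi_lambda _ fun k => hZ.measurable _), fun n t h => ?_⟩
  let Φ : (ℤ → Fin d → ℂ) → (Fin n → Fin m → ℂ) := fun z i => H fun k => z (t i + k)
  have hΦ : Measurable Φ := measurable_pi_lambda _ fun i => hH.comp (hshift (t i))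
  have h1 : (fun ω (i : Fin n) => H fun k => Z (t i + h + k) ω) =
      Φ ∘ fun ω k => Z (k + h) ω := by
    funext ω i
    simp only [Φ, Function.comp]
    congr 1; funext k; congr 1; ring_nf
  have h2 : (fun ω (i : Fin n) => H fun k => Z (t i + k) ω) = Φ ∘ fun ω k => Z k ω := rfl
  rw [h1, h2, ← Measure.map_map hΦ (hZm h),
    ← Measure.map_map hΦ (measurable_pi_lambda _ fun k => hZ.measurable k), hZ.map_shift]

theorem IsStrictlyStationary.map_eq {m : ℕ} {Y : ℤ → Ω → (Fin m → ℂ)}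
    (hY : IsStrictlyStationary P Y) (t : ℤ) : P.map (Y t) = P.map (Y 0) := by
  have h := hY.map_shift 1 (fun _ => 0) t
  have h' := congrArg (Measure.map fun y : Fin 1 → Fin m → ℂ => y 0) h
  rw [Measure.map_map (measurable_pi_apply 0) (measurable_pi_lambda _ fun _ => hY.measurable _),
    Measure.map_map (measurable_pi_apply 0) (measurable_pi_lambda _ fun _ => hY.measurable _)]
    at h'
  simpa [Function.comp_def] using h'

end Shift

/-! ### Reduction to AR(1) -/

section Correction

variable {E F : Type*} [NormedAddCommGroup E] [NormedSpace ℂ E] [NormedAddCommGroup F]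
  [NormedSpace ℂ F] {q : ℕ}

/-- The value at time `0` of the moving average `R` for which `R_t - A R_{t-1}` is the difference
between `∑ k, Θ k Z_{t-k}` and `∑ k, B ^ k (Θ k Z_t)`, where `B` is the inverse of `A`. -/
def maCorrection (A B : E →L[ℂ] E) (Θ : Fin (q + 1) → F →L[ℂ] E) (z : ℤ → F) : E :=
  -∑ k : Fin (q + 1), ∑ j ∈ Finset.range k, (A ^ j) ((B ^ (k : ℕ)) (Θ k (z (-(j : ℤ)))))

/-- For each `k` the terms `A ^ j (B ^ k (Θ k Z_{t-j}))` telescope over `j < k`, and `A ^ k * B ^ k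
= 1` simplifies the last one. -/
theorem maCorrection_sub (A B : E →L[ℂ] E) (hAB : A * B = 1) (Θ : Fin (q + 1) → F →L[ℂ] E)
    (z : ℤ → F) (t : ℤ) :
    maCorrection A B Θ (fun k => z (t + k)) - A (maCorrection A B Θ fun k => z (t - 1 + k)) =
      ∑ k : Fin (q + 1), Θ k (z (t - (k : ℕ))) - ∑ k : Fin (q + 1), (B ^ (k : ℕ)) (Θ k (z t)) := by
  have hpow : ∀ (n : ℕ) (v : E), (A ^ n) ((B ^ n) v) = v := by
    intro n v
    rw [← mul_apply_eq_comp, pow_mul_pow_eq_one n hAB]; rfl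
  have htel : ∀ k : Fin (q + 1),
      ∑ j ∈ Finset.range k, (A ^ j) ((B ^ (k : ℕ)) (Θ k (z (t + -(j : ℤ))))) -
        A (∑ j ∈ Finset.range k, (A ^ j) ((B ^ (k : ℕ)) (Θ k (z (t - 1 + -(j : ℤ)))))) =
      (B ^ (k : ℕ)) (Θ k (z t)) - Θ k (z (t - (k : ℕ))) := by
    intro k
    let g : ℕ → E := fun j => (A ^ j) ((B ^ (k : ℕ)) (Θ k (z (t - (j : ℤ)))))
    have h1 : ∀ j : ℕ, A ((A ^ j) ((B ^ (k : ℕ)) (Θ k (z (t - 1 + -(j : ℤ)))))) = g (j + 1) := by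
      intro j
      have : t - 1 + -(j : ℤ) = t - ((j + 1 : ℕ) : ℤ) := by push_cast; ring
      simp only [g, this, pow_succ']
      rfl
    rw [map_sum, Finset.sum_congr rfl fun j _ => h1 j, ← Finset.sum_sub_distrib]
    have h2 := Finset.sum_range_sub' g (k : ℕ)
    simp only [g, hpow] at h2
    simpa [sub_eq_add_neg, g] using h2
  simp only [maCorrection, map_neg, map_sum (g := A)]
  rw [neg_sub_neg, ← Finset.sum_sub_distrib, ← Finset.sum_sub_distrib]
  refine Finset.sum_congr rfl fun k _ => ?_
  have := htel k
  rw [map_sum] at this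
  rw [← neg_sub, this, neg_sub]

theorem measurable_maCorrection [MeasurableSpace E] [BorelSpace E] [SecondCountableTopology E]
    [MeasurableSpace F] [BorelSpace F] (A B : E →L[ℂ] E) (Θ : Fin (q + 1) → F →L[ℂ] E) :
    Measurable (maCorrection A B Θ) := by
  refine (Finset.measurable_fun_sum _ fun k _ => Finset.measurable_fun_sum _ fun j _ => ?_).neg
  exact ((A ^ j).continuous.comp ((B ^ (k : ℕ)).continuous.comp
    (Θ k).continuous)).measurable.comp (measurable_pi_apply _)

theorem UniformlyTight.maCorrection {Ω : Type*} [MeasurableSpace Ω] {P : Measure Ω}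
    {Z : ℤ → Ω → F} (hZ : UniformlyTight P Z) (A B : E →L[ℂ] E) (Θ : Fin (q + 1) → F →L[ℂ] E) :
    UniformlyTight P fun t ω => maCorrection A B Θ fun k => Z (t + k) ω := by
  refine UniformlyTight.of_norm_le (X := fun t ω => ∑ k : Fin (q + 1), ∑ j ∈ Finset.range k,
    (A ^ j) ((B ^ (k : ℕ)) (Θ k (Z (t + -(j : ℤ)) ω)))) ?_ 1 zero_le_one fun t ω => by
      rw [_root_.maCorrection, norm_neg, one_mul]
  refine UniformlyTight.sum _ fun k _ => UniformlyTight.sum _ fun j _ => ?_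
  exact (((hZ.reindex fun t => t + -(j : ℤ)).clm (Θ k)).clm (B ^ (k : ℕ))).clm (A ^ j)

end Correction

/-! ### Lower bound on the projected powers -/

section Projection

variable {E : Type*} [NormedAddCommGroup E] [NormedSpace ℂ E]

/-- Powers of a boundedly invertible operator, cut off by a commuting projection, shrink vectors
in the range of the projection at most geometrically. -/
theorem geometric_lower_bound {A B P : E →L[ℂ] E} (hBA : B * A = 1) (hPA : Commute P A)
    (hPP : P * P = P) (n : ℕ) (v : E) :
    ((‖B‖ + 2)⁻¹) ^ n * ‖P v‖ ≤ ‖((A * P) ^ n) (P v)‖ := by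
  have h1 : (A * P) ^ n * P = A ^ n * P := by
    have h2 : ∀ n : ℕ, P ^ n * P = P := fun n => by
      induction n with
      | zero => simp
      | succ n ih => rw [pow_succ, mul_assoc, hPP, ih]
    rw [hPA.symm.mul_pow, mul_assoc, h2]
  have h3 : ((A * P) ^ n) (P v) = (A ^ n) (P v) := congr($h1 v)
  have h4 : (B ^ n) ((A ^ n) (P v)) = P v := by
    rw [← mul_apply_eq_comp, pow_mul_pow_eq_one n hBA]; rfl
  rw [h3, inv_pow, inv_mul_le_iff₀ (by positivity)]
  calc ‖P v‖ = ‖(B ^ n) ((A ^ n) (P v))‖ := by rw [h4]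
    _ ≤ ‖B ^ n‖ * ‖(A ^ n) (P v)‖ := (B ^ n).le_opNorm _
    _ ≤ (‖B‖ + 2) ^ n * ‖(A ^ n) (P v)‖ := by
        gcongr
        -- In the zero space the identity has norm `0`, so only `≤ 1` is available at `n = 0`.
        rcases Nat.eq_zero_or_pos n with rfl | hn
        · rw [pow_zero, pow_zero]
          exact ContinuousLinearMap.norm_id_le
        · refine (norm_pow_le' B hn).trans (pow_le_pow_left₀ (norm_nonneg _) (by linarith) n)

end Projection

/-! ### Both implications in operator form -/

section Main

variable {Ω : Type*} [MeasurableSpace Ω] {P : Measure Ω} [IsProbabilityMeasure P] {m d q : ℕ}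
  {Z : ℤ → Ω → (Fin d → ℂ)}

theorem lintegral_posLog_add_lt_top {u v : Ω → ℝ}
    (hum : Measurable u)
    (hu : ∫⁻ ω, ENNReal.ofReal (Real.posLog (u ω)) ∂P < ⊤)
    (hv : ∫⁻ ω, ENNReal.ofReal (Real.posLog (v ω)) ∂P < ⊤) :
    ∫⁻ ω, ENNReal.ofReal (Real.posLog (u ω + v ω)) ∂P < ⊤ := by
  have hm : ∀ {w : Ω → ℝ}, Measurable w → Measurable fun ω => ENNReal.ofReal (Real.posLog (w ω)) :=
    fun hw => (Real.continuous_posLog.measurable.comp hw).ennreal_ofReal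
  calc ∫⁻ ω, ENNReal.ofReal (Real.posLog (u ω + v ω)) ∂P
      ≤ ∫⁻ ω, (ENNReal.ofReal (Real.log 2) + (ENNReal.ofReal (Real.posLog (u ω)) +
          ENNReal.ofReal (Real.posLog (v ω)))) ∂P := by
        refine lintegral_mono fun ω => ?_
        rw [← ENNReal.ofReal_add Real.posLog_nonneg Real.posLog_nonneg,
          ← ENNReal.ofReal_add (Real.log_nonneg one_le_two)
            (add_nonneg Real.posLog_nonneg Real.posLog_nonneg)]
        refine ENNReal.ofReal_le_ofReal ?_
        rw [← add_assoc]
        exact Real.posLog_add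
    _ = ENNReal.ofReal (Real.log 2) + (∫⁻ ω, ENNReal.ofReal (Real.posLog (u ω)) ∂P +
          ∫⁻ ω, ENNReal.ofReal (Real.posLog (v ω)) ∂P) := by
        rw [lintegral_add_left measurable_const, lintegral_add_left (hm hum), lintegral_const,
          measure_univ, mul_one]
    _ < ⊤ := ENNReal.add_lt_top.2 ⟨ENNReal.ofReal_lt_top, ENNReal.add_lt_top.2 ⟨hu, hv⟩⟩

/-- A strictly stationary solution of an AR(1) equation with hyperbolic coefficient, obtained by
summing the stable part over the past and the unstable part over the future, after adding the
moving average correction. -/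
theorem exists_isStrictlyStationary_solution (hZ : IsIIDSequence P Z)
    (A B Q : (Fin m → ℂ) →L[ℂ] (Fin m → ℂ)) (Θ : Fin (q + 1) → (Fin d → ℂ) →L[ℂ] (Fin m → ℂ))
    (hAB : A * B = 1) (hQA : Commute Q A) (hQQ : Q * Q = Q)
    {C₁ ρ₁ : ℝ} (hρ₁ : 0 < ρ₁) (hρ₁' : ρ₁ < 1) (hs : ∀ n : ℕ, ‖(A * Q) ^ n‖ ≤ C₁ * ρ₁ ^ n)
    {C₂ ρ₂ : ℝ} (hρ₂ : 0 < ρ₂) (hρ₂' : ρ₂ < 1) (hu : ∀ n : ℕ, ‖(B * (1 - Q)) ^ n‖ ≤ C₂ * ρ₂ ^ n)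
    (hlog : ∫⁻ ω, ENNReal.ofReal (Real.posLog ‖∑ k : Fin (q + 1), (B ^ (k : ℕ)) (Θ k (Z 0 ω))‖) ∂P
      < ⊤) :
    ∃ Y : ℤ → Ω → (Fin m → ℂ), IsStrictlyStationary P Y ∧
      ∀ᵐ ω ∂P, ∀ t, Y t ω - A (Y (t - 1) ω) = ∑ k : Fin (q + 1), Θ k (Z (t - (k : ℕ)) ω) := by
  let C : (Fin d → ℂ) →L[ℂ] (Fin m → ℂ) := ∑ k : Fin (q + 1), (B ^ (k : ℕ)).comp (Θ k)
  have hC : ∀ z, C z = ∑ k : Fin (q + 1), (B ^ (k : ℕ)) (Θ k z) := fun z => by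
    simp [C]
  simp only [← hC] at hlog
  have hlogB : ∫⁻ ω, ENNReal.ofReal (Real.posLog ‖B (C (Z 0 ω))‖) ∂P < ⊤ :=
    lintegral_posLog_lt_top_of_le (fun _ => norm_nonneg _) ‖B‖ (fun ω => B.le_opNorm _) hlog
  let S : (ℤ → Fin d → ℂ) → (Fin m → ℂ) := fun z =>
    powSeries (A * Q) fun n => C (z (-(n : ℤ)))
  let U : (ℤ → Fin d → ℂ) → (Fin m → ℂ) := fun z =>
    powSeries (B * (1 - Q)) fun n => B (C (z (n + 1)))
  -- The minus sign comes from solving backwards, `X_{t-1} = B X_t - B C Z_t`; hence `U` starts at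
  -- the noise of time `1`.
  let H : (ℤ → Fin d → ℂ) → (Fin m → ℂ) := fun z =>
    Q (S z) - (1 - Q) (U z) + maCorrection A B Θ z
  have hSm : Measurable S := (measurable_powSeries _).comp
    (measurable_pi_lambda _ fun n => C.continuous.measurable.comp (measurable_pi_apply _))
  have hUm : Measurable U := (measurable_powSeries _).comp
    (measurable_pi_lambda _ fun n => (B.continuous.comp C.continuous).measurable.comp
      (measurable_pi_apply _))
  have hHm : Measurable H := ((Q.continuous.measurable.comp hSm).sub
    ((1 - Q).continuous.measurable.comp hUm)).add (measurable_maCorrection A B Θ)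
  refine ⟨_, hZ.isStrictlyStationary hHm, ?_⟩
  have hS : ∀ᵐ ω ∂P, ∀ t : ℤ, Summable fun n : ℕ => ((A * Q) ^ n) (C (Z (t + -(n : ℤ)) ω)) :=
    ae_all_iff.2 fun t => ae_summable_pow_apply _ hρ₁ hρ₁' hs
      (fun n => (hZ.identDistrib _).comp C.continuous.measurable) hlog
  have hU : ∀ᵐ ω ∂P, ∀ t : ℤ,
      Summable fun n : ℕ => ((B * (1 - Q)) ^ n) (B (C (Z (t + (n + 1)) ω))) :=
    ae_all_iff.2 fun t => ae_summable_pow_apply _ hρ₂ hρ₂' hu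
      (fun n => (hZ.identDistrib _).comp (B.continuous.comp C.continuous).measurable) hlogB
  filter_upwards [hS, hU] with ω hSω hUω t
  have hSrec : S (fun k => Z (t + k) ω) =
      C (Z t ω) + A (Q (S fun k => Z (t - 1 + k) ω)) := by
    have e : ∀ n : ℕ, t + -((n + 1 : ℕ) : ℤ) = t - 1 + -(n : ℤ) := fun n => by push_cast; ring
    have h := powSeries_eq_add (A * Q) (hSω t)
      (by simpa only [e] using hSω (t - 1))
    simp only [e, Nat.cast_zero, neg_zero, add_zero] at h
    exact h
  have hUrec : U (fun k => Z (t - 1 + k) ω) =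
      B (C (Z t ω)) + B ((1 - Q) (U fun k => Z (t + k) ω)) := by
    have e : ∀ n : ℕ, t - 1 + (((n + 1 : ℕ) : ℤ) + 1) = t + ((n : ℤ) + 1) := fun n => by
      push_cast; ring
    have h := powSeries_eq_add (B * (1 - Q)) (hUω (t - 1))
      (by simpa only [e] using hUω t)
    simp only [e, Nat.cast_zero, zero_add, sub_add_cancel] at h
    exact h
  have hQA' : ∀ v, Q (A v) = A (Q v) := fun v => congr($hQA v)
  have hQQ' : ∀ v, Q (Q v) = Q v := fun v => congr($hQQ v)
  have hAB' : ∀ v, A (B v) = v := fun v => congr($hAB v)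
  have hcorr := maCorrection_sub A B hAB Θ (fun k => Z k ω) t
  simp only [← hC] at hcorr
  have h1 : Q (S fun k => Z (t + k) ω) =
      Q (C (Z t ω)) + A (Q (S fun k => Z (t - 1 + k) ω)) := by
    rw [hSrec, map_add, hQA', hQQ']
  have h2 : A ((1 - Q) (U fun k => Z (t - 1 + k) ω)) =
      (C (Z t ω) - Q (C (Z t ω))) + (1 - Q) (U fun k => Z (t + k) ω) := by
    rw [hUrec]
    simp only [sub_apply, one_apply_eq_self, map_add, map_sub,
      ← hQA', hAB', hQQ']
    abel
  show Q (S fun k => Z (t + k) ω) - (1 - Q) (U fun k => Z (t + k) ω) +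
      maCorrection A B Θ (fun k => Z (t + k) ω) -
    A (Q (S fun k => Z (t - 1 + k) ω) - (1 - Q) (U fun k => Z (t - 1 + k) ω) +
      maCorrection A B Θ (fun k => Z (t - 1 + k) ω)) = _
  rw [map_add, map_sub, h1, h2, ← sub_eq_zero]
  rw [← sub_eq_zero] at hcorr
  rw [← hcorr]
  abel

/-- A strictly stationary solution forces a finite logarithmic moment of the reduced noise. -/
theorem lintegral_posLog_lt_top_of_isStrictlyStationary (hZ : IsIIDSequence P Z)
    (A B Q : (Fin m → ℂ) →L[ℂ] (Fin m → ℂ)) (Θ : Fin (q + 1) → (Fin d → ℂ) →L[ℂ] (Fin m → ℂ))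
    (hAB : A * B = 1) (hBA : B * A = 1) (hQA : Commute Q A) (hQQ : Q * Q = Q)
    {C₁ C₂ : ℝ} (hC₁ : 0 ≤ C₁) (hC₂ : 0 ≤ C₂)
    (hs : ∀ n : ℕ, ‖(A * Q) ^ n‖ ≤ C₁) (hu : ∀ n : ℕ, ‖(B * (1 - Q)) ^ n‖ ≤ C₂)
    {Y : ℤ → Ω → (Fin m → ℂ)} (hY : IsStrictlyStationary P Y)
    (hsol : ∀ᵐ ω ∂P, ∀ t, Y t ω - A (Y (t - 1) ω) =
      ∑ k : Fin (q + 1), Θ k (Z (t - (k : ℕ)) ω)) :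
    ∫⁻ ω, ENNReal.ofReal (Real.posLog ‖∑ k : Fin (q + 1), (B ^ (k : ℕ)) (Θ k (Z 0 ω))‖) ∂P
      < ⊤ := by
  let C : (Fin d → ℂ) →L[ℂ] (Fin m → ℂ) := ∑ k : Fin (q + 1), (B ^ (k : ℕ)).comp (Θ k)
  have hC : ∀ z, C z = ∑ k : Fin (q + 1), (B ^ (k : ℕ)) (Θ k z) := fun z => by
    simp [C]
  simp only [← hC]
  have hQA' : ∀ v, Q (A v) = A (Q v) := fun v => congr($hQA v)
  have hQQ' : ∀ v, Q (Q v) = Q v := fun v => congr($hQQ v)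
  have hAB' : ∀ v, A (B v) = v := fun v => congr($hAB v)
  have hBA' : ∀ v, B (A v) = v := fun v => congr($hBA v)
  have hQB' : ∀ v, Q (B v) = B (Q v) := fun v => by
    rw [← hBA' (Q (B v)), ← hQA', hAB']
  have hQB : Commute Q B := ContinuousLinearMap.ext hQB'
  -- The summand `2` keeps the rate strictly below one even when `L = 0`.
  have hlt : ∀ L : (Fin m → ℂ) →L[ℂ] (Fin m → ℂ), (‖L‖ + 2)⁻¹ < 1 := fun L =>
    inv_lt_one_of_one_lt₀ (by linarith [norm_nonneg L])
  -- `Y` need not be jointly stationary with `Z`, so `X` need not be stationary; tightness passes to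
  -- it anyway.
  let X : ℤ → Ω → (Fin m → ℂ) := fun t ω =>
    Y t ω + -maCorrection A B Θ fun k => Z (t + k) ω
  have hZt : UniformlyTight P Z :=
    .of_map_eq (hZ.measurable 0) hZ.measurable fun t => (hZ.identDistrib t).map_eq
  have hYt : UniformlyTight P Y := .of_map_eq (hY.measurable 0) hY.measurable hY.map_eq
  have hXt : UniformlyTight P X :=
    hYt.add ((hZt.maCorrection A B Θ).of_norm_le 1 zero_le_one fun t ω => by
      rw [norm_neg, one_mul])
  have hX : ∀ᵐ ω ∂P, ∀ t, X t ω = A (X (t - 1) ω) + C (Z t ω) := by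
    filter_upwards [hsol] with ω hω t
    have hcorr := maCorrection_sub A B hAB Θ (fun k => Z k ω) t
    simp only [← hC] at hcorr
    rw [← hω t, ← sub_eq_zero] at hcorr
    simp only [X, map_add, map_neg]
    rw [← sub_eq_zero, ← neg_eq_zero, ← hcorr]
    abel
  have hinj : Function.Injective fun t : ℤ => -t := neg_injective
  have hstable : ∫⁻ ω, ENNReal.ofReal (Real.posLog ‖Q (C (Z 0 ω))‖) ∂P < ⊤ := by
    have hG : Measurable fun z => Q (C z) := (Q.continuous.comp C.continuous).measurable
    refine lintegral_posLog_lt_top_of_uniformlyTight (A * Q) (W := fun t ω => Q (X t ω))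
      (ζ := fun t ω => Q (C (Z t ω))) hC₁ hs
      (inv_pos.2 (by positivity : (0 : ℝ) < ‖B‖ + 2)) (hlt B)
      (fun t => hG.comp (hZ.measurable t)) (hZ.indep.comp (fun _ z => Q (C z)) fun _ => hG)
      (fun t => (hZ.identDistrib t).comp hG)
      (fun n t ω => geometric_lower_bound hBA hQA hQQ n _) (hXt.clm Q) ?_
    filter_upwards [hX] with ω hω t
    rw [hω t, map_add, hQA']
    simp only [mul_apply_eq_comp, hQQ']
  -- In reversed time, `(1 - Q) X_{-t-1}` satisfies a recursion with operator `B * (1 - Q)` and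
  -- noise `-(1 - Q) B C Z_{-t}`.
  have hunstable : ∫⁻ ω, ENNReal.ofReal (Real.posLog ‖(1 - Q) (-B (C (Z (-0) ω)))‖) ∂P < ⊤ := by
    have hG : Measurable fun z => (1 - Q) (-B (C z)) :=
      ((1 - Q).continuous.comp (B.continuous.comp C.continuous).neg).measurable
    refine lintegral_posLog_lt_top_of_uniformlyTight (B * (1 - Q))
      (W := fun t ω => (1 - Q) (X (-t - 1) ω))
      (ζ := fun t ω => (1 - Q) (-B (C (Z (-t) ω)))) hC₂ hu
      (inv_pos.2 (by positivity : (0 : ℝ) < ‖A‖ + 2)) (hlt A)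
      (fun t => hG.comp (hZ.measurable _))
      ((hZ.indep.precomp hinj).comp (fun _ z => (1 - Q) (-B (C z))) fun _ => hG)
      (fun t => ((hZ.identDistrib (-t)).trans (hZ.identDistrib (-0)).symm).comp hG)
      (fun n t ω => geometric_lower_bound hAB ((Commute.one_left B).sub_left hQB)
        (by rw [mul_sub, sub_mul, sub_mul, hQQ]; simp) n _)
      ((hXt.reindex fun t => -t - 1).clm (1 - Q)) ?_
    filter_upwards [hX] with ω hω t
    have h := hω (-t)
    have e : -(t - 1) - 1 = -t := by ring
    have h1 : X (-t - 1) ω = B (X (-t) ω) + -B (C (Z (-t) ω)) := by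
      rw [h, map_add, hBA']; abel
    rw [h1, map_add, e]
    simp only [mul_apply_eq_comp, sub_apply,
      one_apply_eq_self, map_sub, hQB', hQQ']
    abel
  have hunstable' : ∫⁻ ω, ENNReal.ofReal (Real.posLog ‖(1 - Q) (C (Z 0 ω))‖) ∂P < ⊤ := by
    refine lintegral_posLog_lt_top_of_le (fun _ => norm_nonneg _) ‖A‖ (fun ω => ?_) hunstable
    have : (1 - Q) (C (Z 0 ω)) = A (-(1 - Q) (-B (C (Z (-0) ω)))) := by
      simp only [sub_apply, one_apply_eq_self, map_sub, map_neg,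
        hQB', hAB', neg_zero]
      abel
    rw [this]
    exact (A.le_opNorm _).trans_eq (by rw [norm_neg])
  have hm : ∀ L : (Fin m → ℂ) →L[ℂ] (Fin m → ℂ), Measurable fun ω => ‖L (C (Z 0 ω))‖ := fun L =>
    (L.continuous.comp C.continuous).measurable.norm.comp (hZ.measurable 0)
  refine lintegral_posLog_lt_top_of_le (fun _ => norm_nonneg _) 1 (fun ω => ?_)
    (lintegral_posLog_add_lt_top (hm Q) hstable hunstable')
  rw [one_mul]
  calc ‖C (Z 0 ω)‖ = ‖Q (C (Z 0 ω)) + (1 - Q) (C (Z 0 ω))‖ := by simp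
    _ ≤ _ := norm_add_le _ _

end Main

/-! ### Translation to matrices and an arbitrary norm -/

theorem corollary1 {Ω : Type*} [MeasurableSpace Ω] (P : Measure Ω) [IsProbabilityMeasure P]
    (m d q : ℕ) (hm : 1 ≤ m) (hd : 1 ≤ d)
    (Z : ℤ → Ω → (Fin d → ℂ)) (hZ : IsIIDSequence P Z)
    (Ψ : Matrix (Fin m) (Fin m) ℂ) (Θ : Fin (q + 1) → Matrix (Fin m) (Fin d) ℂ)
    -- an arbitrary norm on `ℂ^m`
    (N : Seminorm ℂ (Fin m → ℂ)) (hN : ∀ x, N x = 0 → x = 0)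
    (hΨ : ∀ μ : ℂ, Module.End.HasEigenvalue (Matrix.toLin' Ψ) μ →
      ‖μ‖ ∈ Set.Ioo (0 : ℝ) 1 ∪ Set.Ioi (1 : ℝ)) :
    (∃ Y : ℤ → Ω → (Fin m → ℂ), IsStrictlyStationary P Y ∧ SolvesARMAOne P Ψ Θ Z Y) ↔
      ∫⁻ ω, ENNReal.ofReal (Real.log (max 1
        (N ((∑ k : Fin (q + 1), Ψ ^ (q - (k : ℕ)) * Θ k) *ᵥ Z 0 ω)))) ∂P < ⊤ := by
  let A : (Fin m → ℂ) →L[ℂ] (Fin m → ℂ) := LinearMap.toContinuousLinearMap (Matrix.toLin' Ψ)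
  let Θ' : Fin (q + 1) → (Fin d → ℂ) →L[ℂ] (Fin m → ℂ) := fun k =>
    LinearMap.toContinuousLinearMap (Matrix.toLin' (Θ k))
  have hA : ∀ (μ : ℂ) (v : Fin m → ℂ), v ≠ 0 → A v = μ • v → ‖μ‖ ≠ 0 ∧ ‖μ‖ ≠ 1 := by
    intro μ v hv hμ
    have h := hΨ μ (Module.End.hasEigenvalue_of_hasEigenvector
      ⟨Module.End.mem_eigenspace_iff.2 hμ, hv⟩)
    rcases h with ⟨h0, h1⟩ | h1
    · exact ⟨h0.ne', h1.ne⟩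
    · have h1' : 1 < ‖μ‖ := h1
      exact ⟨by linarith, h1'.ne'⟩
  obtain ⟨B, Q, hAB, hBA, hQA, hQQ, ⟨C₁, ρ₁, hC₁, hρ₁, hρ₁', hs⟩, C₂, ρ₂, hC₂, hρ₂, hρ₂', hu⟩ :=
    exists_hyperbolic_splitting A hA
  obtain ⟨c, hc⟩ := exists_seminorm_equiv N hN
  let M : Matrix (Fin m) (Fin d) ℂ := ∑ k : Fin (q + 1), Ψ ^ (q - (k : ℕ)) * Θ k
  have hApow : ∀ (n : ℕ) (v : Fin m → ℂ), (A ^ n) v = (Ψ ^ n) *ᵥ v := by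
    intro n
    induction n with
    | zero => intro v; simp
    | succ n ih =>
      intro v
      rw [pow_succ, pow_succ, mul_apply_eq_comp, ih, ← Matrix.mulVec_mulVec]
      rfl
  have hBA_pow : ∀ (n : ℕ) (v : Fin m → ℂ), (B ^ n) ((A ^ n) v) = v := by
    intro n v
    rw [← mul_apply_eq_comp, pow_mul_pow_eq_one n hBA]; rfl
  have hAB_pow : ∀ (n : ℕ) (v : Fin m → ℂ), (A ^ n) ((B ^ n) v) = v := by
    intro n v
    rw [← mul_apply_eq_comp, pow_mul_pow_eq_one n hAB]; rfl
  -- `A ^ (q - k) = A ^ q * B ^ k` for `k ≤ q`; the truncated subtraction is harmless.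
  have hM : ∀ z, M *ᵥ z = (A ^ q) (∑ k : Fin (q + 1), (B ^ (k : ℕ)) (Θ' k z)) := by
    intro z
    rw [map_sum, Matrix.sum_mulVec]
    refine Finset.sum_congr rfl fun k _ => ?_
    have hk : q - (k : ℕ) + k = q := Nat.sub_add_cancel (Nat.lt_succ_iff.1 k.2)
    have hpow : A ^ q = A ^ (q - (k : ℕ)) * A ^ (k : ℕ) := by rw [← pow_add, hk]
    rw [hpow, mul_apply_eq_comp, hAB_pow, hApow, ← Matrix.mulVec_mulVec]
    rfl
  have hlog : ∀ ω, Real.log (max 1 (N (M *ᵥ Z 0 ω))) = Real.posLog (N (M *ᵥ Z 0 ω)) := fun ω =>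
    (Real.posLog_eq_log_max_one (apply_nonneg N _)).symm
  change _ ↔ ∫⁻ ω, ENNReal.ofReal (Real.log (max 1 (N (M *ᵥ Z 0 ω)))) ∂P < ⊤
  simp only [hlog]
  constructor
  · rintro ⟨Y, hY, hsol⟩
    have hgeo : ∀ {C ρ : ℝ}, 0 ≤ C → 0 < ρ → ρ < 1 → ∀ n : ℕ, C * ρ ^ n ≤ C :=
      fun hC h0 h1 n => mul_le_of_le_one_right hC (pow_le_one₀ h0.le h1.le)
    have h := lintegral_posLog_lt_top_of_isStrictlyStationary hZ A B Q Θ' hAB hBA hQA hQQ hC₁ hC₂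
      (fun n => (hs n).trans (hgeo hC₁ hρ₁ hρ₁' n)) (fun n => (hu n).trans (hgeo hC₂ hρ₂ hρ₂' n))
      hY hsol
    refine lintegral_posLog_lt_top_of_le (fun _ => apply_nonneg N _) (|c| * ‖A ^ q‖)
      (fun ω => ?_) h
    calc N (M *ᵥ Z 0 ω) ≤ c * ‖M *ᵥ Z 0 ω‖ := (hc _).1
      _ ≤ |c| * ‖M *ᵥ Z 0 ω‖ := by gcongr; exact le_abs_self c
      _ ≤ |c| * (‖A ^ q‖ * _) := by rw [hM]; gcongr; exact (A ^ q).le_opNorm _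
      _ = _ := (mul_assoc _ _ _).symm
  · intro h
    refine exists_isStrictlyStationary_solution hZ A B Q Θ' hAB hQA hQQ hρ₁ hρ₁' hs
      hρ₂ hρ₂' hu (lintegral_posLog_lt_top_of_le (fun _ => norm_nonneg _) (‖B ^ q‖ * c)
        (fun ω => ?_) h)
    calc ‖∑ k : Fin (q + 1), (B ^ (k : ℕ)) (Θ' k (Z 0 ω))‖ = ‖(B ^ q) (M *ᵥ Z 0 ω)‖ := by
          rw [hM, hBA_pow]
      _ ≤ ‖B ^ q‖ * ‖M *ᵥ Z 0 ω‖ := (B ^ q).le_opNorm _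
      _ ≤ ‖B ^ q‖ * (c * N (M *ᵥ Z 0 ω)) := by gcongr; exact (hc _).2
      _ = _ := (mul_assoc _ _ _).symm
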